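/- For a Borel set $A \subseteq \mathbb{R}^{n}$, let $\mathcal{P}(A)$ be the set of Borel probability measures $\mu$ on $\mathbb{R}^n$ with $\mu(A)=1$, let $\widehat{\mu}(\xi) = \int e^{-2\pi i \langle \xi, x\rangle}\, d\mu(x)$, and define the Fourier dimension of $A$ by \[ \dim_F A = \sup\left\{ s \in [0,n] : \exists\, \mu \in \mathcal{P}(A),\ \exists\, C < \infty \text{ such that } |\widehat{\mu}(\xi)| \le C |\xi|^{-s/2} \text{ for all } \xi \in \mathbb{R}^n \setminus \{0\} \right\}. \] Theorem. For every integer $d \ge 1$, the cone \[ \Gamma^d = \left\{ (x, x_{d+1}) \in \mathbb{R}^{d}\times\mathbb{R} : |x| = |x_{d+1}| \right\} \subseteq \mathbb{R}^{d+1}, \] where $|x|$ is the Euclidean norm, has Fourier dimension $\dim_F \Gamma^d = d-1$. -/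

import Mathlib

open MeasureTheory

noncomputable section

/-- The Euclidean space `ℝⁿ`. -/
abbrev RSpace (n : ℕ) : Type := EuclideanSpace ℝ (Fin n)

/-- The Fourier transform `ξ ↦ ∫ exp (-2πi ⟨ξ, x⟩) dμ(x)` of a finite Borel measure on `ℝⁿ`. -/
def measureFourier {n : ℕ} (μ : Measure (RSpace n)) (ξ : RSpace n) : ℂ :=
  ∫ x, Complex.exp (-2 * Real.pi * Complex.I * (inner ℝ ξ x : ℝ)) ∂μ

/-- `|μ^(ξ)| ≲ |ξ| ^ (-s/2)`, with an implicit constant independent of `ξ`. At `ξ = 0` the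
right-hand side is to be read as `+∞` when `s > 0` (and as `1` when `s = 0`), so the bound carries
no information there and only `ξ ≠ 0` is considered. -/
def HasFourierDecay {n : ℕ} (μ : Measure (RSpace n)) (s : ℝ) : Prop :=
  ∃ C : ℝ, ∀ ξ : RSpace n, ξ ≠ 0 → ‖measureFourier μ ξ‖ ≤ C * ‖ξ‖ ^ (-s / 2)

/-- The exponents `s ∈ [0, n]` such that some Borel probability measure `μ` on `ℝⁿ` with
`μ(A) = 1` satisfies `|μ^(ξ)| ≲ |ξ| ^ (-s/2)`. -/
def fourierExponents {n : ℕ} (A : Set (RSpace n)) : Set ℝ :=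
  {s : ℝ | s ∈ Set.Icc (0 : ℝ) n ∧
    ∃ μ : Measure (RSpace n), IsProbabilityMeasure μ ∧ μ A = 1 ∧ HasFourierDecay μ s}

/-- The Fourier dimension of a (Borel) set `A ⊆ ℝⁿ`. -/
def fourierDim {n : ℕ} (A : Set (RSpace n)) : ℝ :=
  sSup (fourierExponents A)

/-- The cone `{(x, x_{d+1}) ∈ ℝᵈ × ℝ : |x| = |x_{d+1}|}` in `ℝ^(d+1)`. -/
def cone (d : ℕ) : Set (RSpace (d + 1)) :=
  {x | ‖(WithLp.toLp 2 (fun i : Fin d => x i.castSucc) : RSpace d)‖ = |x (Fin.last d)|}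

/-- For nonempty `A` the supremum in the definition of `fourierDim` is a genuine one. -/
theorem isLUB_fourierDim {n : ℕ} {A : Set (RSpace n)} (hA : A.Nonempty) :
    IsLUB (fourierExponents A) (fourierDim A) := by
  obtain ⟨a, ha⟩ := hA
  refine isLUB_csSup ⟨0, ⟨le_refl _, Nat.cast_nonneg n⟩, Measure.dirac a, inferInstance, ?_, 1, ?_⟩
    ⟨n, fun s hs => hs.1.2⟩
  · exact Measure.dirac_apply_of_mem ha
  · intro ξ _
    have h : measureFourier (Measure.dirac a) ξ =
        Complex.exp (((-2 * Real.pi * inner ℝ ξ a : ℝ) : ℂ) * Complex.I) := by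
      rw [measureFourier, integral_dirac]
      congr 1
      push_cast
      ring
    rw [h, Complex.norm_exp_ofReal_mul_I]
    simp

end

open Filter Topology FourierTransform

noncomputable section

/-! Put `d = m + 1` and use null coordinates in which the cone is `|y|² = uv`.

Upper bound. Let `μ` live on the cone with decay exponent `s > m`. Average its transform over a
paraboloid of size `R` in the dual cone, with Gaussian weight, and smear it in a null direction to
localize in `u`. At a cone point with `u ≠ 0` the phase is `Ru|z + y/u|²`: its critical value is
zero for every point, so the Gaussian average is asymptotic to `R^(-m/2)` times a positive quantity
times a unimodular constant depending only on the sign of `u` (`integral_paraboloidPoint`,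
`tendsto_rpow_mul_paraboloidKernel`). Nothing cancels between points near a fixed `u ≠ 0`, while
decay makes the pairing `O(R^(-s/2))`. Hence `μ` is carried by `u = 0`, and its transform is
constant along the normal of that hyperplane, contradicting decay (`fourierExponents_cone_le`).

Lower bound. Smooth measure on the points `t(1, z, |z|²)` has phase `t(a + ⟨b,z⟩ + c|z|²)`. The
Gaussian integral in `z` gains `(4c² + |b|²)^(-m/4)`; when `b` and `c` are small compared with `a`,
integration in `t` gives rapid decay. Balancing the two yields every `s < m`
(`hasFourierDecay_coneMeasure`), enough for the supremum. -/

/-- The character `t ↦ exp (-2πit)` of the real line. -/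
def unitWave (t : ℝ) : ℂ := Complex.exp (-2 * Real.pi * Complex.I * t)

theorem norm_unitWave (t : ℝ) : ‖unitWave t‖ = 1 := by
  rw [unitWave, show -2 * (Real.pi : ℂ) * Complex.I * t = ((-2 * Real.pi * t : ℝ) : ℂ) * Complex.I by
    push_cast; ring, Complex.norm_exp_ofReal_mul_I]

theorem unitWave_add (s t : ℝ) : unitWave (s + t) = unitWave s * unitWave t := by
  simp only [unitWave, ← Complex.exp_add]
  congr 1
  push_cast
  ring

@[fun_prop]
theorem continuous_unitWave : Continuous unitWave := by
  unfold unitWave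
  fun_prop

theorem measureFourier_eq {n : ℕ} (μ : Measure (RSpace n)) (ξ : RSpace n) :
    measureFourier μ ξ = ∫ x, unitWave (inner ℝ ξ x) ∂μ := rfl

theorem norm_measureFourier_le_one {n : ℕ} (μ : Measure (RSpace n)) [IsProbabilityMeasure μ]
    (ξ : RSpace n) : ‖measureFourier μ ξ‖ ≤ 1 := by
  rw [measureFourier_eq]
  refine (norm_integral_le_integral_norm _).trans ?_
  simp [norm_unitWave]

theorem fourier_eq_integral_unitWave (f : ℝ → ℂ) (w : ℝ) :
    𝓕 f w = ∫ v, unitWave (v * w) * f v := by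
  rw [Real.fourier_real_eq_integral_exp_smul]
  congr 1 with v
  rw [smul_eq_mul, unitWave]
  congr 2
  push_cast
  ring

/-! ### Light-cone coordinates -/

/-- The point of `ℝ^(m+2)` with light-cone coordinates `u`, `v` and transversal part `y`. -/
def lightVec {m : ℕ} (u : ℝ) (y : RSpace m) (v : ℝ) : RSpace (m + 2) :=
  WithLp.toLp 2 (Fin.snoc (Fin.snoc (fun i => y i) ((v - u) / 2) : Fin (m + 1) → ℝ) ((u + v) / 2) :
    Fin (m + 2) → ℝ)

/-- In `(u, v)` the embedding is an orthogonal map scaled by `1/√2`, whence the factor `1/2`;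
frequencies are later given null coordinates `2a`, `2c` to cancel it. -/
theorem inner_lightVec {m : ℕ} (a c u v : ℝ) (b y : RSpace m) :
    inner ℝ (lightVec a b c) (lightVec u y v) = inner ℝ b y + (a * u + c * v) / 2 := by
  simp only [lightVec, PiLp.inner_apply, Fin.sum_univ_castSucc, Fin.snoc_castSucc, Fin.snoc_last,
    RCLike.inner_apply, conj_trivial]
  ring

theorem norm_sq_lightVec {m : ℕ} (u v : ℝ) (y : RSpace m) :
    ‖lightVec u y v‖ ^ 2 = ‖y‖ ^ 2 + (u ^ 2 + v ^ 2) / 2 := by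
  rw [← real_inner_self_eq_norm_sq, inner_lightVec, real_inner_self_eq_norm_sq]
  ring

theorem abs_le_two_mul_norm_lightVec {m : ℕ} (u v : ℝ) (y : RSpace m) :
    |v| ≤ 2 * ‖lightVec u y v‖ := by
  refine abs_le_of_sq_le_sq ?_ (by positivity)
  have := norm_sq_lightVec u v y
  nlinarith [sq_nonneg ‖y‖, sq_nonneg u, sq_nonneg v]

theorem exists_eq_lightVec {m : ℕ} (x : RSpace (m + 2)) : ∃ u y v, x = lightVec u y v := by
  refine ⟨x (Fin.last _) - x (Fin.last m).castSucc, WithLp.toLp 2 fun i => x i.castSucc.castSucc,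
    x (Fin.last _) + x (Fin.last m).castSucc, ?_⟩
  ext i
  refine Fin.lastCases ?_ (fun i => ?_) i
  · simp [lightVec]
  · refine Fin.lastCases ?_ (fun i => ?_) i
    · simp [lightVec]
    · simp [lightVec]

theorem lightVec_mem_cone {m : ℕ} (u v : ℝ) (y : RSpace m) :
    lightVec u y v ∈ cone (m + 1) ↔ ‖y‖ ^ 2 = u * v := by
  have h : ‖(WithLp.toLp 2 (fun i : Fin (m + 1) => lightVec u y v i.castSucc) :
      RSpace (m + 1))‖ ^ 2 = ‖y‖ ^ 2 + ((v - u) / 2) ^ 2 := by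
    simp [EuclideanSpace.norm_sq_eq, lightVec, Fin.sum_univ_castSucc]
  have h' : |lightVec u y v (Fin.last (m + 1))| ^ 2 = ((u + v) / 2) ^ 2 := by
    simp [lightVec]
  rw [cone, Set.mem_ofPred_eq, ← sq_eq_sq₀ (norm_nonneg _) (abs_nonneg _), h, h']
  constructor <;> intro h <;> linarith

@[fun_prop]
theorem Continuous.lightVec {X : Type*} [TopologicalSpace X] {m : ℕ} {u v : X → ℝ}
    {y : X → RSpace m} (hu : Continuous u) (hy : Continuous y) (hv : Continuous v) :
    Continuous fun x => lightVec (u x) (y x) (v x) := by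
  unfold _root_.lightVec
  refine (PiLp.continuous_toLp 2 _).comp ?_
  refine Continuous.finSnoc (Continuous.finSnoc ?_ (by fun_prop)) (by fun_prop)
  fun_prop

theorem isClosed_cone (d : ℕ) : IsClosed (cone d) := by
  refine isClosed_eq ?_ (by fun_prop)
  exact ((PiLp.continuous_toLp 2 _).comp (by fun_prop)).norm

/-! ### Gaussian integrals with quadratic phase -/

theorem integrable_exp_neg_mul_norm_sq (m : ℕ) {r : ℝ} (hr : 0 < r) :
    Integrable fun z : RSpace m => Real.exp (-r * ‖z‖ ^ 2) := by
  have h := (GaussianFourier.integrable_cexp_neg_mul_sq_norm_add (b := r) (V := RSpace m)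
    (by simpa using hr) 0 0).norm
  refine h.congr (ae_of_all _ fun z => ?_)
  simp only [Complex.norm_exp]
  simp [← Complex.ofReal_pow, ← Complex.ofReal_mul, ← Complex.ofReal_neg]

theorem integral_gaussian_eq_one (m : ℕ) :
    ∫ z : RSpace m, Real.exp (-Real.pi * ‖z‖ ^ 2) = 1 := by
  rw [GaussianFourier.integral_rexp_neg_mul_sq_norm Real.pi_pos, div_self Real.pi_ne_zero,
    Real.one_rpow]

/-- The quadratic phase only turns the width `π` into `π(1 + 2ic)`, whose real part stays positive.
-/
theorem integral_gaussian_mul_unitWave {m : ℕ} (b : RSpace m) (c : ℝ) :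
    ∫ z : RSpace m, Real.exp (-Real.pi * ‖z‖ ^ 2) * unitWave (inner ℝ b z + c * ‖z‖ ^ 2) =
      (1 / (1 + 2 * Complex.I * c)) ^ ((m / 2 : ℝ) : ℂ) *
        Complex.exp (-Real.pi * ‖b‖ ^ 2 / (1 + 2 * Complex.I * c)) := by
  have hpi : (Real.pi : ℂ) ≠ 0 := by exact_mod_cast Real.pi_ne_zero
  have hc : (1 + 2 * Complex.I * c : ℂ) ≠ 0 := fun h => by
    simpa using congrArg Complex.re h
  have h := GaussianFourier.integral_cexp_neg_mul_sq_norm_add (V := RSpace m)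
    (b := Real.pi * (1 + 2 * Complex.I * c)) (by simpa using Real.pi_pos)
    (-2 * Real.pi * Complex.I) b
  convert h using 2
  · congr 1 with z
    rw [unitWave, Complex.ofReal_exp, ← Complex.exp_add]
    congr 1
    push_cast
    ring
  · congr 1
    · field_simp
    · simp
  · congr 1
    field_simp
    rw [Complex.I_sq]
    ring

/-! ### Upper bound: averaging over dual paraboloids -/

/-- The first light-cone coordinate. -/
def lightU {m : ℕ} (x : RSpace (m + 2)) : ℝ := inner ℝ (lightVec 2 0 0) x

/-- The second light-cone coordinate. -/
def lightV {m : ℕ} (x : RSpace (m + 2)) : ℝ := inner ℝ (lightVec 0 0 2) x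

@[fun_prop]
theorem continuous_lightU {m : ℕ} : Continuous (lightU (m := m)) := by
  unfold lightU
  fun_prop

@[fun_prop]
theorem continuous_lightV {m : ℕ} : Continuous (lightV (m := m)) := by
  unfold lightV
  fun_prop

theorem lightU_lightVec {m : ℕ} (u v : ℝ) (y : RSpace m) : lightU (lightVec u y v) = u := by
  rw [lightU, inner_lightVec]
  simp

theorem lightV_lightVec {m : ℕ} (u v : ℝ) (y : RSpace m) : lightV (lightVec u y v) = v := by
  rw [lightV, inner_lightVec]
  simp

/-- The Fourier transform at a point of the cone with light-cone coordinates `u`, `v` of the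
Gaussian measure on a paraboloid of size `R` in the dual cone. -/
def paraboloidKernel (k R u v : ℝ) : ℂ :=
  (1 / (1 + 2 * Complex.I * (R * u : ℝ))) ^ (k : ℂ) *
    Complex.exp (-2 * Real.pi * Complex.I * R * v / (1 + 2 * Complex.I * (R * u : ℝ)))

theorem one_add_two_I_mul_ne_zero (c : ℝ) : (1 + 2 * Complex.I * c : ℂ) ≠ 0 := fun h => by
  simpa using congrArg Complex.re h

/-- A point of a dilated paraboloid in the dual cone, translated in a null direction. -/
def paraboloidPoint {m : ℕ} (R : ℝ) (p : RSpace m × ℝ) : RSpace (m + 2) :=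
  lightVec (2 * R * ‖p.1‖ ^ 2 + 2 * p.2) ((2 * R) • p.1) (2 * R)

@[fun_prop]
theorem continuous_paraboloidPoint {m : ℕ} (R : ℝ) :
    Continuous (paraboloidPoint (m := m) R) := by
  unfold paraboloidPoint
  fun_prop

theorem le_norm_paraboloidPoint {m : ℕ} (R : ℝ) (p : RSpace m × ℝ) :
    R ≤ ‖paraboloidPoint R p‖ := by
  have := abs_le_two_mul_norm_lightVec (2 * R * ‖p.1‖ ^ 2 + 2 * p.2) (2 * R) ((2 * R) • p.1)
  have h := le_abs_self (2 * R)
  rw [paraboloidPoint]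
  linarith

/-- The variables separate: the null translation integrates to `𝓕 Θ` at `u`, the paraboloid to a
complex Gaussian. -/
theorem integral_paraboloidPoint {m : ℕ} (R : ℝ) (Θ : ℝ → ℂ) {x : RSpace (m + 2)}
    (hx : x ∈ cone (m + 1)) :
    ∫ p : RSpace m × ℝ, (Real.exp (-Real.pi * ‖p.1‖ ^ 2) * Θ p.2) *
        unitWave (inner ℝ (paraboloidPoint R p) x) =
      𝓕 Θ (lightU x) * paraboloidKernel (m / 2) R (lightU x) (lightV x) := by
  obtain ⟨u, y, v, rfl⟩ := exists_eq_lightVec x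
  rw [lightVec_mem_cone] at hx
  rw [lightU_lightVec, lightV_lightVec]
  have hD := one_add_two_I_mul_ne_zero (R * u)
  calc _ = ∫ p : RSpace m × ℝ, (Real.exp (-Real.pi * ‖p.1‖ ^ 2) *
        unitWave (inner ℝ ((2 * R) • y) p.1 + R * u * ‖p.1‖ ^ 2)) *
        (unitWave (R * v) * (unitWave (p.2 * u) * Θ p.2)) := by
        congr 1 with p
        rw [paraboloidPoint, inner_lightVec]
        have : inner ℝ ((2 * R) • p.1) y +
            ((2 * R * ‖p.1‖ ^ 2 + 2 * p.2) * u + 2 * R * v) / 2 =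
            (inner ℝ ((2 * R) • y) p.1 + R * u * ‖p.1‖ ^ 2) + (R * v + p.2 * u) := by
          rw [real_inner_smul_left, real_inner_smul_left, real_inner_comm]
          ring
        rw [this, unitWave_add, unitWave_add (R * v)]
        ring
    _ = _ := by
        rw [Measure.volume_eq_prod, integral_prod_mul (μ := (volume : Measure (RSpace m)))
          (fun z => Real.exp (-Real.pi * ‖z‖ ^ 2) *
            unitWave (inner ℝ ((2 * R) • y) z + R * u * ‖z‖ ^ 2))
          (fun η => unitWave (R * v) * (unitWave (η * u) * Θ η)),
          integral_gaussian_mul_unitWave, integral_const_mul, ← fourier_eq_integral_unitWave,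
          paraboloidKernel, unitWave]
        rw [show ∀ a b c d : ℂ, a * b * (c * d) = d * (a * (b * c)) by intros; ring,
          ← Complex.exp_add]
        congr 4
        -- The cone equation eliminates `y`; the terms `4πR²uv` then cancel in the combined
        -- exponent.
        have hy : (‖(2 * R) • y‖ : ℂ) ^ 2 = 4 * R ^ 2 * (u * v) := by
          rw [norm_smul, ← Complex.ofReal_pow, mul_pow, hx, Real.norm_eq_abs, sq_abs]
          push_cast
          ring
        rw [hy]
        field_simp
        push_cast
        linear_combination (-4 * (R : ℂ) ^ 2 * u * v) * Complex.I_sq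

theorem integral_mul_measureFourier_paraboloidPoint {m : ℕ} (R : ℝ) {Θ : ℝ → ℂ}
    (hΘ : Integrable Θ) (μ : Measure (RSpace (m + 2))) [IsProbabilityMeasure μ]
    (hμ : ∀ᵐ x ∂μ, x ∈ cone (m + 1)) :
    ∫ p : RSpace m × ℝ, (Real.exp (-Real.pi * ‖p.1‖ ^ 2) * Θ p.2) *
        measureFourier μ (paraboloidPoint R p) =
      ∫ x, 𝓕 Θ (lightU x) * paraboloidKernel (m / 2) R (lightU x) (lightV x) ∂μ := by
  simp only [measureFourier_eq, ← integral_const_mul]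
  rw [integral_integral_swap]
  · exact integral_congr_ae (hμ.mono fun x hx => integral_paraboloidPoint R Θ hx)
  · have h : Integrable (fun p : RSpace m × ℝ =>
        ((Real.exp (-Real.pi * ‖p.1‖ ^ 2) : ℝ) : ℂ) * Θ p.2) :=
      (integrable_exp_neg_mul_norm_sq m Real.pi_pos).ofReal.mul_prod hΘ
    refine (h.comp_fst μ).mul_bdd (c := 1) (Continuous.aestronglyMeasurable ?_)
      (ae_of_all _ fun q => (norm_unitWave _).le)
    fun_prop

/-- Fourier decay of a measure carried by the cone forces its pairing with the kernels of large
paraboloids to be small. -/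
theorem norm_integral_paraboloidKernel_le {m : ℕ} {s : ℝ} (hs : 0 ≤ s) {Θ : ℝ → ℂ}
    (hΘ : Integrable Θ) (μ : Measure (RSpace (m + 2))) [IsProbabilityMeasure μ]
    (hμ : ∀ᵐ x ∂μ, x ∈ cone (m + 1)) (hdec : HasFourierDecay μ s) :
    ∃ C : ℝ, ∀ R : ℝ, 0 < R →
      ‖∫ x, 𝓕 Θ (lightU x) * paraboloidKernel (m / 2) R (lightU x) (lightV x) ∂μ‖ ≤
        C * R ^ (-s / 2) := by
  obtain ⟨C, hC⟩ := hdec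
  have h : Integrable (fun p : RSpace m × ℝ =>
      ((Real.exp (-Real.pi * ‖p.1‖ ^ 2) : ℝ) : ℂ) * Θ p.2) :=
    (integrable_exp_neg_mul_norm_sq m Real.pi_pos).ofReal.mul_prod hΘ
  refine ⟨(∫ p : RSpace m × ℝ, ‖((Real.exp (-Real.pi * ‖p.1‖ ^ 2) : ℝ) : ℂ) * Θ p.2‖) * |C|,
    fun R hR => ?_⟩
  rw [← integral_mul_measureFourier_paraboloidPoint R hΘ μ hμ, mul_assoc, ← integral_mul_const]
  refine norm_integral_le_of_norm_le (h.norm.mul_const _) (ae_of_all _ fun p => ?_)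
  rw [norm_mul]
  refine mul_le_mul_of_nonneg_left ?_ (norm_nonneg _)
  have hp := le_norm_paraboloidPoint R p
  refine (hC _ (norm_pos_iff.1 (hR.trans_le hp))).trans ?_
  exact mul_le_mul (le_abs_self C) (Real.rpow_le_rpow_of_nonpos hR hp (by linarith))
    (by positivity) (abs_nonneg C)

/-! ### Upper bound: the kernel as `R → ∞` -/

theorem norm_one_div_one_add_le {R u : ℝ} (hR : 0 < R) (hu : u ≠ 0) :
    R * ‖1 / (1 + 2 * Complex.I * (R * u : ℝ))‖ ≤ 1 / |u| := by
  have h : |2 * (R * u)| ≤ ‖(1 + 2 * Complex.I * (R * u : ℝ) : ℂ)‖ := by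
    simpa using Complex.abs_im_le_norm (1 + 2 * Complex.I * (R * u : ℝ) : ℂ)
  rw [abs_mul, abs_mul, abs_two, abs_of_pos hR] at h
  have hu' := abs_pos.2 hu
  have hD : 0 < ‖(1 + 2 * Complex.I * (R * u : ℝ) : ℂ)‖ := by
    refine lt_of_lt_of_le ?_ h
    positivity
  rw [norm_div, norm_one, mul_one_div, div_le_div_iff₀ hD hu']
  nlinarith [mul_pos hR hu']

/-- The exponent has real part `-4πR²uv / (1 + 4R²u²)`. -/
theorem norm_exp_paraboloid_le_one {R u v : ℝ} (huv : 0 ≤ u * v) :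
    ‖Complex.exp (-2 * Real.pi * Complex.I * R * v / (1 + 2 * Complex.I * (R * u : ℝ)))‖ ≤ 1 := by
  rw [Complex.norm_exp, Real.exp_le_one_iff, Complex.div_re]
  have h : 0 ≤ Complex.normSq (1 + 2 * Complex.I * (R * u : ℝ)) := Complex.normSq_nonneg _
  have h2 : 0 ≤ 2 * Real.pi * R * v * (2 * (R * u)) /
      Complex.normSq (1 + 2 * Complex.I * (R * u : ℝ)) := by
    refine div_nonneg ?_ h
    have : 0 ≤ 4 * Real.pi * R ^ 2 * (u * v) := by positivity
    linarith
  simp only [neg_mul, Complex.ofReal_mul, Complex.neg_re, Complex.mul_re, Complex.re_ofNat,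
    Complex.ofReal_re, Complex.im_ofNat, Complex.ofReal_im, mul_zero, sub_zero, Complex.I_re,
    Complex.mul_im, zero_mul, add_zero, Complex.I_im, mul_one, zero_add, Complex.add_re,
    Complex.one_re, Complex.neg_im, Complex.add_im, Complex.one_im] at h2 ⊢
  simp only [neg_zero, zero_div, zero_add, neg_div] at h2 ⊢
  linarith

theorem norm_rpow_mul_paraboloidKernel_le {k R u v : ℝ} (hk : 0 ≤ k) (hR : 0 < R) (hu : u ≠ 0)
    (huv : 0 ≤ u * v) : ‖((R ^ k : ℝ) : ℂ) * paraboloidKernel k R u v‖ ≤ (1 / |u|) ^ k := by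
  rw [paraboloidKernel, norm_mul, norm_mul, Complex.norm_cpow_real, Complex.norm_real,
    Real.norm_of_nonneg (by positivity), ← mul_assoc, ← Real.mul_rpow hR.le (norm_nonneg _)]
  refine (mul_le_of_le_one_right (by positivity) (norm_exp_paraboloid_le_one huv)).trans ?_
  exact Real.rpow_le_rpow (by positivity) (norm_one_div_one_add_le hR hu) hk

/-- A positive factor leaves the argument unchanged, so no branch is crossed. -/
theorem ofReal_mul_cpow_of_pos {r : ℝ} (hr : 0 < r) {z : ℂ} (hz : z ≠ 0) (k : ℝ) :
    (r * z : ℂ) ^ (k : ℂ) = ((r ^ k : ℝ) : ℂ) * z ^ (k : ℂ) := by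
  have hr' : (r : ℂ) ≠ 0 := by exact_mod_cast hr.ne'
  rw [Complex.ofReal_cpow hr.le, Complex.cpow_def_of_ne_zero (mul_ne_zero hr' hz),
    Complex.log_ofReal_mul hr hz, Complex.ofReal_log hr.le, add_mul, Complex.exp_add,
    ← Complex.cpow_def_of_ne_zero hr', ← Complex.cpow_def_of_ne_zero hz]

/-- Absorbing `R^k` turns the base into `1/(R⁻¹ + 2iu)`. Its limit is nonzero imaginary, where the
principal power is continuous. -/
theorem tendsto_rpow_mul_paraboloidKernel (k : ℝ) {u : ℝ} (v : ℝ) (hu : u ≠ 0) :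
    Tendsto (fun R : ℝ => ((R ^ k : ℝ) : ℂ) * paraboloidKernel k R u v) atTop
      (𝓝 ((1 / (2 * Complex.I * u)) ^ (k : ℂ) * Real.exp (-Real.pi * v / u))) := by
  have hu' : (u : ℂ) ≠ 0 := by exact_mod_cast hu
  have hlim : Tendsto (fun R : ℝ => 1 / ((R⁻¹ : ℝ) + 2 * Complex.I * u : ℂ)) atTop
      (𝓝 (1 / (2 * Complex.I * u))) := by
    have h0 : Tendsto (fun R : ℝ => ((R⁻¹ : ℝ) : ℂ)) atTop (𝓝 ((0 : ℝ) : ℂ)) :=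
      (Complex.continuous_ofReal.tendsto 0).comp tendsto_inv_atTop_zero
    have h1 := h0.add_const (2 * Complex.I * u : ℂ)
    rw [Complex.ofReal_zero, zero_add] at h1
    exact tendsto_const_nhds.div h1 (by simp [hu'])
  have hslit : (1 / (2 * Complex.I * u) : ℂ) ∈ Complex.slitPlane := by
    refine Or.inr ?_
    have : (1 / (2 * Complex.I * u) : ℂ) = ((-(1 / (2 * u)) : ℝ) : ℂ) * Complex.I := by
      push_cast
      field_simp
      rw [Complex.I_sq, neg_neg]
    rw [this, Complex.im_ofReal_mul, Complex.I_im]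
    simp [hu]
  have hpow := ((continuousAt_id.cpow continuousAt_const hslit).tendsto.comp hlim :
    Tendsto (fun R : ℝ => (1 / ((R⁻¹ : ℝ) + 2 * Complex.I * u : ℂ)) ^ (k : ℂ)) atTop _)
  have hexp := (Complex.continuous_exp.tendsto _).comp
    (hlim.const_mul (-2 * Real.pi * Complex.I * v : ℂ))
  have h := hpow.mul hexp
  have hval : Complex.exp (-2 * Real.pi * Complex.I * v * (1 / (2 * Complex.I * u))) =
      Real.exp (-Real.pi * v / u) := by
    push_cast
    congr 1
    field_simp
  rw [hval] at h
  refine h.congr' ?_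
  filter_upwards [eventually_gt_atTop 0] with R hR
  have hRc : (R : ℂ) ≠ 0 := by exact_mod_cast hR.ne'
  have hD := one_add_two_I_mul_ne_zero (R * u)
  have hq : 1 / ((R⁻¹ : ℝ) + 2 * Complex.I * u : ℂ) =
      R * (1 / (1 + 2 * Complex.I * (R * u : ℝ))) := by
    have : ((R⁻¹ : ℝ) + 2 * Complex.I * u : ℂ) = (1 + 2 * Complex.I * (R * u : ℝ)) / R := by
      push_cast
      field_simp
    rw [this]
    field_simp
  have hRk : (R * (1 / (1 + 2 * Complex.I * (R * u : ℝ))) : ℂ) ^ (k : ℂ) =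
      ((R ^ k : ℝ) : ℂ) * (1 / (1 + 2 * Complex.I * (R * u : ℝ))) ^ (k : ℂ) := by
    exact ofReal_mul_cpow_of_pos hR (one_div_ne_zero hD) k
  simp only [Function.comp_apply, id, hq, hRk, paraboloidKernel]
  rw [mul_assoc]
  congr 3
  field_simp

/-! ### Upper bound: localization in `u` -/

/-- A smooth bump on the real line is the Fourier transform of an integrable function. -/
theorem exists_integrable_fourier_eq_bump {c : ℝ} (f : ContDiffBump c) :
    ∃ Θ : ℝ → ℂ, Integrable Θ ∧ ∀ t, 𝓕 Θ t = (f t : ℂ) := by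
  have hcs : HasCompactSupport fun t => (f t : ℂ) :=
    f.hasCompactSupport.comp_left (g := fun r : ℝ => (r : ℂ)) Complex.ofReal_zero
  have hcd : ContDiff ℝ ((⊤ : ℕ∞) : WithTop ℕ∞) fun t => (f t : ℂ) :=
    Complex.ofRealCLM.contDiff.comp f.contDiff
  let φ : SchwartzMap ℝ ℂ := hcs.toSchwartzMap hcd
  let Θ : SchwartzMap ℝ ℂ := 𝓕⁻ φ
  refine ⟨Θ, Θ.integrable, fun t => ?_⟩
  rw [← SchwartzMap.fourier_coe, FourierTransform.fourier_fourierInv_eq]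
  rfl

theorem ContDiffBump.dist_lt_of_ne_zero {c t : ℝ} (f : ContDiffBump c) (h : f t ≠ 0) :
    |t - c| < f.rOut := by
  have : t ∈ Function.support f := h
  rwa [f.support_eq, Metric.mem_ball, Real.dist_eq] at this

theorem abs_div_eq_of_abs_sub_lt {c t : ℝ} (hc : c ≠ 0) (h : |t - c| < |c| / 2) :
    |c| / 2 < |t| ∧ |c| / c = |t| / t := by
  rcases lt_or_gt_of_ne hc with hc' | hc'
  · rw [abs_of_neg hc'] at h ⊢
    have h' := (abs_lt.1 h).2
    have ht : t < 0 := by linarith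
    rw [abs_of_neg ht, neg_div_self hc, neg_div_self ht.ne]
    exact ⟨by linarith, rfl⟩
  · rw [abs_of_pos hc'] at h ⊢
    have h' := (abs_lt.1 h).1
    have ht : 0 < t := by linarith
    rw [abs_of_pos ht, div_self hc, div_self ht.ne']
    exact ⟨by linarith, rfl⟩

theorem lightU_mul_lightV_nonneg {m : ℕ} {x : RSpace (m + 2)} (hx : x ∈ cone (m + 1)) :
    0 ≤ lightU x * lightV x := by
  obtain ⟨u, y, v, rfl⟩ := exists_eq_lightVec x
  rw [lightVec_mem_cone] at hx
  rw [lightU_lightVec, lightV_lightVec, ← hx]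
  positivity

@[fun_prop]
theorem measurable_paraboloidKernel (k R : ℝ) {m : ℕ} :
    Measurable fun x : RSpace (m + 2) => paraboloidKernel k R (lightU x) (lightV x) := by
  unfold paraboloidKernel
  have hu : Measurable (lightU (m := m)) := continuous_lightU.measurable
  have hv : Measurable (lightV (m := m)) := continuous_lightV.measurable
  fun_prop

/-- If the pairings with the paraboloid kernels are `o(R ^ (-k))`, then so is the mass of the
support of the bump. -/
theorem ae_bump_lightU_eq_zero {m : ℕ} {k : ℝ} (hk : 0 ≤ k) (μ : Measure (RSpace (m + 2)))
    [IsProbabilityMeasure μ] (hμ : ∀ᵐ x ∂μ, x ∈ cone (m + 1)) {c : ℝ} (hc : c ≠ 0)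
    (f : ContDiffBump c) (hf : f.rOut ≤ |c| / 2)
    (hlim : Tendsto (fun R : ℝ => ((R ^ k : ℝ) : ℂ) *
      ∫ x, (f (lightU x) : ℂ) * paraboloidKernel k R (lightU x) (lightV x) ∂μ) atTop (𝓝 0)) :
    ∀ᵐ x ∂μ, f (lightU x) = 0 := by
  have hu : Measurable (lightU (m := m)) := continuous_lightU.measurable
  have hv : Measurable (lightV (m := m)) := continuous_lightV.measurable
  have hfu : Measurable fun x : RSpace (m + 2) => f (lightU x) :=
    f.continuous.measurable.comp hu
  have hsupp : ∀ x : RSpace (m + 2), f (lightU x) ≠ 0 →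
      |c| / 2 < |lightU x| ∧ |c| / c = |lightU x| / lightU x := fun x hx =>
    abs_div_eq_of_abs_sub_lt hc ((f.dist_lt_of_ne_zero hx).trans_le hf)
  have hc' : 0 < |c| := abs_pos.2 hc
  have hne : ∀ x : RSpace (m + 2), f (lightU x) ≠ 0 → lightU x ≠ 0 := fun x hx => by
    have := (hsupp x hx).1
    exact abs_pos.1 (by linarith)
  have hle : ∀ x : RSpace (m + 2), f (lightU x) ≠ 0 →
      (1 / |lightU x|) ^ k ≤ (2 / |c|) ^ k := fun x hx => by
    have := (hsupp x hx).1
    have hpos : 0 < |lightU x| := by linarith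
    refine Real.rpow_le_rpow (by positivity) ?_ hk
    rw [div_le_div_iff₀ hpos hc']
    linarith
  -- The limiting phase `(-i sgn u)^k`, constant on the support of the bump because `u` keeps the
  -- sign of `c` there.
  set ω : ℂ := ((|c| / c : ℝ) / Complex.I) ^ (k : ℂ) with hω
  have hω0 : ω ≠ 0 := by
    rw [hω, Ne, Complex.cpow_eq_zero_iff]
    rintro ⟨h, -⟩
    simp [hc] at h
  set h : RSpace (m + 2) → ℝ := fun x =>
    f (lightU x) * ((1 / (2 * |lightU x|)) ^ k * Real.exp (-Real.pi * lightV x / lightU x)) with hh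
  have hlim' : Tendsto (fun R : ℝ => ∫ x, ((R ^ k : ℝ) : ℂ) *
      ((f (lightU x) : ℂ) * paraboloidKernel k R (lightU x) (lightV x)) ∂μ) atTop
      (𝓝 (∫ x, ω * (h x : ℂ) ∂μ)) := by
    refine tendsto_integral_filter_of_dominated_convergence (fun _ => (2 / |c|) ^ k) ?_ ?_
      (integrable_const _) ?_
    · refine Eventually.of_forall fun R => Measurable.aestronglyMeasurable ?_
      exact ((Complex.measurable_ofReal.comp hfu).mul
        (measurable_paraboloidKernel k R)).const_mul _
    · filter_upwards [eventually_gt_atTop 0] with R hR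
      filter_upwards [hμ] with x hx
      rw [mul_left_comm, norm_mul, Complex.norm_real, Real.norm_of_nonneg f.nonneg]
      rcases eq_or_ne (f (lightU x)) 0 with h0 | h0
      · rw [h0, zero_mul]
        positivity
      · refine (mul_le_of_le_one_left (norm_nonneg _) f.le_one).trans ?_
        exact (norm_rpow_mul_paraboloidKernel_le hk hR (hne x h0)
          (lightU_mul_lightV_nonneg hx)).trans (hle x h0)
    · refine ae_of_all _ fun x => ?_
      rcases eq_or_ne (f (lightU x)) 0 with h0 | h0
      · simp [hh, h0]
      · have ht := (tendsto_rpow_mul_paraboloidKernel k (lightV x) (hne x h0)).const_mul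
          (f (lightU x) : ℂ)
        have hpos : 0 < |lightU x| := abs_pos.2 (hne x h0)
        have hux : (lightU x : ℂ) ≠ 0 := by exact_mod_cast hne x h0
        have habs : ((|lightU x| : ℝ) : ℂ) ≠ 0 := by exact_mod_cast hpos.ne'
        have hpow : (1 / (2 * Complex.I * lightU x) : ℂ) ^ (k : ℂ) =
            (((1 / (2 * |lightU x|)) ^ k : ℝ) : ℂ) * ω := by
          rw [hω, ← ofReal_mul_cpow_of_pos (by positivity) (by simp [hc]), (hsupp x h0).2]
          congr 1
          push_cast
          field_simp
        rw [hpow] at ht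
        refine (ht.congr fun R => by ring).trans (le_of_eq ?_)
        congr 1
        simp only [hh]
        push_cast
        ring
  simp only [integral_const_mul] at hlim'
  have hzero := tendsto_nhds_unique hlim' hlim
  rw [mul_eq_zero, or_iff_right hω0, integral_complex_ofReal, Complex.ofReal_eq_zero] at hzero
  have hnonneg : ∀ x, 0 ≤ h x := fun x => by
    have := f.nonneg (x := lightU x)
    positivity
  have hint : Integrable h μ := by
    refine Integrable.of_bound (C := (2 / |c|) ^ k) (Measurable.aestronglyMeasurable ?_) ?_
    · exact hfu.mul (((measurable_const.div (hu.abs.const_mul 2)).pow_const k).mul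
        (Real.measurable_exp.comp ((hv.const_mul _).div hu)))
    · filter_upwards [hμ] with x hx
      rw [Real.norm_of_nonneg (hnonneg x)]
      rcases eq_or_ne (f (lightU x)) 0 with h0 | h0
      · simp only [hh, h0, zero_mul]
        positivity
      · have hpos : 0 < |lightU x| := abs_pos.2 (hne x h0)
        refine (mul_le_of_le_one_left (by positivity) f.le_one).trans ?_
        refine le_trans ?_ (hle x h0)
        refine (mul_le_of_le_one_right (by positivity) ?_).trans ?_
        · rw [Real.exp_le_one_iff, neg_mul, neg_div, neg_nonpos, mul_div_assoc]
          refine mul_nonneg Real.pi_pos.le ?_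
          -- Here `v/u = uv · u⁻²`, nonnegative on the cone.
          rw [div_eq_mul_inv, ← mul_self_mul_inv (lightU x)⁻¹, inv_inv]
          have := mul_nonneg (lightU_mul_lightV_nonneg hx) (mul_self_nonneg (lightU x)⁻¹)
          linarith
        · refine Real.rpow_le_rpow (by positivity) ?_ hk
          exact one_div_le_one_div_of_le hpos (by linarith)
  filter_upwards [(integral_eq_zero_iff_of_nonneg hnonneg hint).1 hzero] with x hx
  by_contra h0
  have hpos : 0 < |lightU x| := abs_pos.2 (hne x h0)
  have : h x ≠ 0 := by
    simp only [hh]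
    positivity
  exact this hx

/-- A measure on the cone in `ℝ^(m+2)` with Fourier decay of order greater than `m / 2` is carried
by a ruling. -/
theorem ae_lightU_eq_zero {m : ℕ} {s : ℝ} (hs : m < s) (μ : Measure (RSpace (m + 2)))
    [IsProbabilityMeasure μ] (hμ : ∀ᵐ x ∂μ, x ∈ cone (m + 1)) (hdec : HasFourierDecay μ s) :
    ∀ᵐ x ∂μ, lightU x = 0 := by
  have hm : (0 : ℝ) ≤ m := m.cast_nonneg
  -- Local nullity suffices; the outer radius `|u|/2` keeps each bump on one side of `u = 0`.
  refine measure_null_of_locally_null _ fun x (hx : ¬ lightU x = 0) => ?_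
  have hpos : 0 < |lightU x| := abs_pos.2 hx
  let f : ContDiffBump (lightU x) := ⟨|lightU x| / 4, |lightU x| / 2, by linarith, by linarith⟩
  refine ⟨{z | f (lightU z) ≠ 0}, mem_nhdsWithin_of_mem_nhds ?_, ?_⟩
  · refine (isOpen_ne_fun (f.continuous.comp continuous_lightU) continuous_const).mem_nhds ?_
    exact (f.pos_of_mem_ball (Metric.mem_ball_self f.rOut_pos)).ne'
  · refine ae_bump_lightU_eq_zero (k := m / 2) (by positivity) μ hμ hx f le_rfl ?_
    obtain ⟨Θ, hΘ, hfΘ⟩ := exists_integrable_fourier_eq_bump f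
    obtain ⟨C, hC⟩ := norm_integral_paraboloidKernel_le (by linarith) hΘ μ hμ hdec
    simp only [hfΘ] at hC
    have hdecay : Tendsto (fun R : ℝ => C * R ^ (-((s - m) / 2))) atTop (𝓝 0) := by
      simpa using (tendsto_rpow_neg_atTop (y := (s - m) / 2) (by linarith)).const_mul C
    refine squeeze_zero_norm' ?_ hdecay
    filter_upwards [eventually_gt_atTop 0] with R hR
    rw [norm_mul, Complex.norm_real, Real.norm_of_nonneg (by positivity)]
    refine (mul_le_mul_of_nonneg_left (hC R hR) (by positivity)).trans (le_of_eq ?_)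
    rw [mul_left_comm, ← Real.rpow_add hR]
    congr 2
    ring

theorem fourierExponents_cone_le {m : ℕ} {s : ℝ} (hs : s ∈ fourierExponents (cone (m + 1))) :
    s ≤ m := by
  obtain ⟨-, μ, hprob, hA, hdec⟩ := hs
  by_contra! hlt
  have hm : (0 : ℝ) ≤ m := m.cast_nonneg
  have hμ : ∀ᵐ x ∂μ, x ∈ cone (m + 1) := by
    rw [ae_iff]
    exact (prob_compl_eq_zero_iff (isClosed_cone _).measurableSet).2 hA
  have hu := ae_lightU_eq_zero hlt μ hμ hdec
  -- The direction tested is normal to the hyperplane `u = 0`.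
  have hone : ∀ t : ℝ, measureFourier μ (t • lightVec 2 0 0) = 1 := fun t => by
    rw [measureFourier_eq, integral_congr_ae (g := fun _ => 1)]
    · simp
    · filter_upwards [hu] with x hx
      rw [real_inner_smul_left, ← lightU, hx, mul_zero]
      simp [unitWave]
  obtain ⟨C, hC⟩ := hdec
  have hnorm : 0 < ‖(lightVec 2 0 0 : RSpace (m + 2))‖ := by
    have := norm_sq_lightVec 2 0 (0 : RSpace m)
    by_contra! h
    have h0 : ‖(lightVec 2 0 0 : RSpace (m + 2))‖ = 0 := le_antisymm h (norm_nonneg _)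
    rw [h0] at this
    norm_num at this
  have hlim : Tendsto (fun t : ℝ => C * ‖t • (lightVec 2 0 0 : RSpace (m + 2))‖ ^ (-s / 2)) atTop
      (𝓝 (C * 0)) := by
    refine Tendsto.const_mul C ?_
    rw [neg_div]
    refine (tendsto_rpow_neg_atTop (y := s / 2) (by linarith)).comp ?_
    simp only [norm_smul, Real.norm_eq_abs]
    exact tendsto_abs_atTop_atTop.atTop_mul_const hnorm
  have h1 : (1 : ℝ) ≤ C * 0 := by
    refine ge_of_tendsto hlim ?_
    filter_upwards [eventually_gt_atTop 0] with t ht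
    have := hC (t • lightVec 2 0 0) (smul_ne_zero ht.ne' (norm_pos_iff.1 hnorm))
    rwa [hone, norm_one] at this
  linarith

/-! ### Lower bound: uniform Gaussian estimate -/

theorem exists_rpow_le_mul_exp (k : ℝ) :
    ∃ K : ℝ, 0 < K ∧ ∀ Y : ℝ, 0 ≤ Y → (1 + Y) ^ k ≤ K * Real.exp Y := by
  refine ⟨(Nat.factorial ⌈k⌉₊ : ℝ) * Real.exp 1, by positivity, fun Y hY => ?_⟩
  have h1 : (1 : ℝ) ≤ 1 + Y := by linarith
  calc (1 + Y) ^ k ≤ (1 + Y) ^ ((⌈k⌉₊ : ℕ) : ℝ) :=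
        Real.rpow_le_rpow_of_exponent_le h1 (Nat.le_ceil k)
    _ = (1 + Y) ^ ⌈k⌉₊ := Real.rpow_natCast _ _
    _ ≤ Nat.factorial ⌈k⌉₊ * Real.exp (1 + Y) := by
        have := Real.pow_div_factorial_le_exp (1 + Y) (by linarith) ⌈k⌉₊
        rwa [div_le_iff₀' (by positivity)] at this
    _ = _ := by rw [Real.exp_add, mul_assoc]

/-- With `Y = |b|²/(1 + 4c²)` the integral has modulus `(1 + 4c²)^(-m/4) exp(-πY)`. Since `1 + 4c² +
|b|² = (1 + 4c²)(1 + Y)`, it remains to absorb `(1 + Y)^(m/4)` into the exponential. -/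
theorem exists_norm_integral_gaussian_le (m : ℕ) :
    ∃ K : ℝ, 0 < K ∧ ∀ (b : RSpace m) (c : ℝ),
      ‖∫ z : RSpace m, Real.exp (-Real.pi * ‖z‖ ^ 2) * unitWave (inner ℝ b z + c * ‖z‖ ^ 2)‖ ≤
        K * (1 + (4 * c ^ 2 + ‖b‖ ^ 2)) ^ (-(m / 4 : ℝ)) := by
  obtain ⟨K, hK, hKY⟩ := exists_rpow_le_mul_exp (m / 4)
  refine ⟨K, hK, fun b c => ?_⟩
  have hX : 0 < 1 + 4 * c ^ 2 := by positivity
  have hsq : Complex.normSq (1 + 2 * Complex.I * c) = 1 + 4 * c ^ 2 := by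
    simp [Complex.normSq_apply]
    ring
  have hnorm : ‖(1 + 2 * Complex.I * c : ℂ)‖ = (1 + 4 * c ^ 2) ^ (1 / 2 : ℝ) := by
    rw [← hsq, ← Real.sqrt_eq_rpow]
    rfl
  have hre : (-Real.pi * ‖b‖ ^ 2 / (1 + 2 * Complex.I * c) : ℂ).re =
      -Real.pi * (‖b‖ ^ 2 / (1 + 4 * c ^ 2)) := by
    rw [show (-Real.pi * ‖b‖ ^ 2 : ℂ) = ((-Real.pi * ‖b‖ ^ 2 : ℝ) : ℂ) by push_cast; ring,
      Complex.div_re, hsq, Complex.ofReal_re, Complex.ofReal_im]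
    simp
    ring
  rw [integral_gaussian_mul_unitWave, norm_mul, Complex.norm_cpow_real, Complex.norm_exp, hre,
    norm_div, norm_one, hnorm]
  set Y := ‖b‖ ^ 2 / (1 + 4 * c ^ 2) with hY
  have hY0 : 0 ≤ Y := by positivity
  have hprod : 1 + (4 * c ^ 2 + ‖b‖ ^ 2) = (1 + 4 * c ^ 2) * (1 + Y) := by
    rw [hY]
    field_simp
    ring
  have hpow : (1 / (1 + 4 * c ^ 2) ^ (1 / 2 : ℝ)) ^ (m / 2 : ℝ) =
      (1 + 4 * c ^ 2) ^ (-(m / 4 : ℝ)) := by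
    rw [one_div, ← Real.rpow_neg hX.le, ← Real.rpow_mul hX.le]
    congr 1
    ring
  rw [hpow, hprod, Real.mul_rpow hX.le (by linarith), mul_left_comm]
  refine mul_le_mul_of_nonneg_left ?_ (by positivity)
  rw [Real.rpow_neg (by linarith), ← div_eq_mul_inv, le_div_iff₀ (by positivity)]
  have hexp : Real.exp (-Real.pi * Y) ≤ Real.exp (-Y) := by
    refine Real.exp_le_exp.2 ?_
    nlinarith [Real.pi_gt_three]
  calc Real.exp (-Real.pi * Y) * (1 + Y) ^ (m / 4 : ℝ)
      ≤ Real.exp (-Y) * (K * Real.exp Y) :=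
        mul_le_mul hexp (hKY Y hY0) (by positivity) (by positivity)
    _ = K := by rw [mul_left_comm, ← Real.exp_add, neg_add_cancel, Real.exp_zero, mul_one]

/-! ### Lower bound: a smooth measure on the cone -/

/-- A smooth probability density supported in `(1, 3)`. -/
def radialDensity : ℝ → ℝ :=
  (⟨1 / 2, 1, by norm_num, by norm_num⟩ : ContDiffBump (2 : ℝ)).normed volume

theorem radialDensity_nonneg (t : ℝ) : 0 ≤ radialDensity t := ContDiffBump.nonneg_normed _ _

@[fun_prop]
theorem continuous_radialDensity : Continuous radialDensity := ContDiffBump.continuous_normed _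

theorem integrable_radialDensity : Integrable radialDensity := ContDiffBump.integrable_normed _

theorem integral_radialDensity : ∫ t, radialDensity t = 1 := ContDiffBump.integral_normed _

theorem one_le_of_radialDensity_ne_zero {t : ℝ} (ht : radialDensity t ≠ 0) : 1 ≤ t := by
  have : t ∈ Function.support radialDensity := ht
  rw [radialDensity, ContDiffBump.support_normed_eq, Metric.mem_ball, Real.dist_eq] at this
  have := (abs_lt.1 this).1
  simp only at this
  linarith

theorem exists_norm_fourier_radialDensity_le (N : ℕ) :
    ∃ C : ℝ, 0 < C ∧ ∀ τ : ℝ, |τ| ^ N * ‖∫ t, radialDensity t * unitWave (t * τ)‖ ≤ C := by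
  have hcs : HasCompactSupport fun t => (radialDensity t : ℂ) :=
    (ContDiffBump.hasCompactSupport_normed _).comp_left (g := fun r : ℝ => (r : ℂ))
      Complex.ofReal_zero
  have hcd : ContDiff ℝ ((⊤ : ℕ∞) : WithTop ℕ∞) fun t => (radialDensity t : ℂ) :=
    Complex.ofRealCLM.contDiff.comp (ContDiffBump.contDiff_normed _)
  let φ : SchwartzMap ℝ ℂ := hcs.toSchwartzMap hcd
  let ψ : SchwartzMap ℝ ℂ := 𝓕 φ
  obtain ⟨C, hC, h⟩ := ψ.decay N 0
  refine ⟨C, hC, fun τ => ?_⟩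
  have hτ := h τ
  rw [norm_iteratedFDeriv_zero, Real.norm_eq_abs] at hτ
  have : ψ τ = ∫ t, radialDensity t * unitWave (t * τ) := by
    change (𝓕 φ : SchwartzMap ℝ ℂ) τ = _
    rw [SchwartzMap.fourier_coe, fourier_eq_integral_unitWave]
    congr 1 with t
    rw [mul_comm]
    rfl
  rwa [this] at hτ

theorem norm_fourier_radialDensity_le_one (τ : ℝ) :
    ‖∫ t, radialDensity t * unitWave (t * τ)‖ ≤ 1 := by
  refine (norm_integral_le_integral_norm _).trans (le_of_eq ?_)
  simp only [norm_mul, norm_unitWave, Complex.norm_real, mul_one,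
    Real.norm_of_nonneg (radialDensity_nonneg _), integral_radialDensity]

/-- The density of the parameters `(t, z)` of the cone measure. -/
def coneDensity {m : ℕ} (p : ℝ × RSpace m) : ℝ :=
  radialDensity p.1 * Real.exp (-Real.pi * ‖p.2‖ ^ 2)

theorem coneDensity_nonneg {m : ℕ} (p : ℝ × RSpace m) : 0 ≤ coneDensity p :=
  mul_nonneg (radialDensity_nonneg _) (Real.exp_pos _).le

theorem continuous_coneDensity {m : ℕ} : Continuous (coneDensity (m := m)) := by
  unfold coneDensity
  fun_prop

theorem integrable_coneDensity {m : ℕ} : Integrable (coneDensity (m := m)) :=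
  integrable_radialDensity.mul_prod (integrable_exp_neg_mul_norm_sq m Real.pi_pos)

theorem integral_coneDensity {m : ℕ} : ∫ p : ℝ × RSpace m, coneDensity p = 1 := by
  have := integral_prod_mul (μ := (volume : Measure ℝ)) (ν := (volume : Measure (RSpace m)))
    radialDensity fun z => Real.exp (-Real.pi * ‖z‖ ^ 2)
  rwa [integral_radialDensity, integral_gaussian_eq_one, mul_one] at this

/-- The parametrization of the cone by `(t, z) ↦ t (1, z, |z|²)` in light-cone coordinates. -/
def conePoint {m : ℕ} (p : ℝ × RSpace m) : RSpace (m + 2) :=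
  lightVec p.1 (p.1 • p.2) (p.1 * ‖p.2‖ ^ 2)

theorem continuous_conePoint {m : ℕ} : Continuous (conePoint (m := m)) := by
  unfold conePoint
  fun_prop

theorem conePoint_mem_cone {m : ℕ} (p : ℝ × RSpace m) : conePoint p ∈ cone (m + 1) := by
  rw [conePoint, lightVec_mem_cone, norm_smul, mul_pow, Real.norm_eq_abs, sq_abs]
  ring

/-- A smooth probability measure on the cone. -/
def coneMeasure (m : ℕ) : Measure (RSpace (m + 2)) :=
  (volume.withDensity fun p : ℝ × RSpace m => ENNReal.ofReal (coneDensity p)).map conePoint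

instance isProbabilityMeasure_coneMeasure (m : ℕ) : IsProbabilityMeasure (coneMeasure m) := by
  have : IsProbabilityMeasure
      (volume.withDensity fun p : ℝ × RSpace m => ENNReal.ofReal (coneDensity p)) := by
    refine ⟨?_⟩
    rw [withDensity_apply _ MeasurableSet.univ, Measure.restrict_univ,
      ← ofReal_integral_eq_lintegral_ofReal integrable_coneDensity
        (ae_of_all _ coneDensity_nonneg), integral_coneDensity, ENNReal.ofReal_one]
  exact Measure.isProbabilityMeasure_map continuous_conePoint.aemeasurable

theorem coneMeasure_cone (m : ℕ) : coneMeasure m (cone (m + 1)) = 1 := by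
  rw [← measure_univ (μ := coneMeasure m), coneMeasure,
    Measure.map_apply continuous_conePoint.measurable (isClosed_cone _).measurableSet,
    Measure.map_apply continuous_conePoint.measurable MeasurableSet.univ]
  congr 1
  ext p
  simp [conePoint_mem_cone]

theorem measureFourier_coneMeasure {m : ℕ} (a c : ℝ) (b : RSpace m) :
    measureFourier (coneMeasure m) (lightVec (2 * a) b (2 * c)) =
      ∫ p : ℝ × RSpace m, coneDensity p *
        unitWave (p.1 * (a + (inner ℝ b p.2 + c * ‖p.2‖ ^ 2))) := by
  rw [measureFourier_eq, coneMeasure, integral_map continuous_conePoint.aemeasurable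
    (Continuous.aestronglyMeasurable (by fun_prop)), integral_withDensity_eq_integral_toReal_smul
    continuous_coneDensity.measurable.ennreal_ofReal (ae_of_all _ fun p => ENNReal.ofReal_lt_top)]
  congr 1 with p
  rw [ENNReal.toReal_ofReal (coneDensity_nonneg p), Complex.real_smul, conePoint, inner_lightVec,
    real_inner_smul_right]
  congr 2
  ring

theorem integrable_coneDensity_mul_unitWave {m : ℕ} (a c : ℝ) (b : RSpace m) :
    Integrable fun p : ℝ × RSpace m => (coneDensity p : ℂ) *
      unitWave (p.1 * (a + (inner ℝ b p.2 + c * ‖p.2‖ ^ 2))) :=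
  integrable_coneDensity.ofReal.mul_bdd (c := 1) (Continuous.aestronglyMeasurable (by fun_prop))
    (ae_of_all _ fun p => (norm_unitWave _).le)

/-! ### Lower bound: decay of the cone measure -/

/-- Decay of the Fourier transform of the cone measure away from the conormal of the ruling
missed by the parametrization. -/
theorem exists_norm_measureFourier_coneMeasure_le (m : ℕ) :
    ∃ K : ℝ, 0 < K ∧ ∀ (a c : ℝ) (b : RSpace m), 0 < 4 * c ^ 2 + ‖b‖ ^ 2 →
      ‖measureFourier (coneMeasure m) (lightVec (2 * a) b (2 * c))‖ ≤
        K * (4 * c ^ 2 + ‖b‖ ^ 2) ^ (-(m / 4 : ℝ)) := by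
  obtain ⟨K, hK, hbound⟩ := exists_norm_integral_gaussian_le m
  refine ⟨K, hK, fun a c b hQ => ?_⟩
  rw [measureFourier_coneMeasure, Measure.volume_eq_prod,
    integral_prod _ (integrable_coneDensity_mul_unitWave a c b)]
  set B := K * (4 * c ^ 2 + ‖b‖ ^ 2) ^ (-(m / 4 : ℝ)) with hB
  have hB' : ∫ t, radialDensity t * B = B := by
    rw [integral_mul_const, integral_radialDensity, one_mul]
  rw [← hB']
  refine norm_integral_le_of_norm_le (integrable_radialDensity.mul_const B)
    (ae_of_all _ fun t => ?_)
  have heq : ∫ z : RSpace m, (coneDensity (t, z) : ℂ) *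
        unitWave (t * (a + (inner ℝ b z + c * ‖z‖ ^ 2))) =
      (radialDensity t * unitWave (t * a)) * ∫ z : RSpace m, Real.exp (-Real.pi * ‖z‖ ^ 2) *
        unitWave (inner ℝ (t • b) z + t * c * ‖z‖ ^ 2) := by
    rw [← integral_const_mul]
    congr 1 with z
    rw [mul_add, unitWave_add, coneDensity, real_inner_smul_left,
      show t * (inner ℝ b z + c * ‖z‖ ^ 2) = t * inner ℝ b z + t * c * ‖z‖ ^ 2 by ring]
    push_cast
    ring
  simp only [heq]
  rw [norm_mul, norm_mul, norm_unitWave, mul_one, Complex.norm_real,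
    Real.norm_of_nonneg (radialDensity_nonneg t)]
  rcases eq_or_ne (radialDensity t) 0 with h0 | h0
  · simp [h0]
  · have ht := one_le_of_radialDensity_ne_zero h0
    refine mul_le_mul_of_nonneg_left ((hbound _ _).trans ?_) (radialDensity_nonneg t)
    refine mul_le_mul_of_nonneg_left ?_ hK.le
    -- Scaling `(b, c)` by `t ≥ 1` only enlarges the quadratic form.
    refine Real.rpow_le_rpow_of_nonpos hQ ?_ (neg_nonpos.2 (by positivity))
    rw [norm_smul, Real.norm_eq_abs, mul_pow |t|, sq_abs]
    have h1 : 1 ≤ t ^ 2 := one_le_pow₀ ht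
    nlinarith [mul_le_mul_of_nonneg_right h1 hQ.le]

theorem abs_quadratic_le {m : ℕ} {M c : ℝ} {b : RSpace m} (hb : ‖b‖ ≤ M) (hc : 2 * |c| ≤ M)
    (z : RSpace m) : |inner ℝ b z + c * ‖z‖ ^ 2| ≤ M * (1 + ‖z‖ ^ 2) := by
  have h1 : |inner ℝ b z| ≤ M * ‖z‖ :=
    (abs_real_inner_le_norm b z).trans (mul_le_mul_of_nonneg_right hb (norm_nonneg z))
  have h2 : |c * ‖z‖ ^ 2| ≤ M / 2 * ‖z‖ ^ 2 := by
    rw [abs_mul, abs_of_nonneg (sq_nonneg ‖z‖)]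
    exact mul_le_mul_of_nonneg_right (by linarith) (sq_nonneg _)
  have h3 := abs_add_le (inner ℝ b z) (c * ‖z‖ ^ 2)
  have hM : 0 ≤ M := (norm_nonneg b).trans hb
  nlinarith [mul_nonneg hM (sq_nonneg (‖z‖ - 1))]

/-- Rapid decay of the Fourier transform of the cone measure near the conormal of the ruling
missed by the parametrization. -/
theorem exists_pow_mul_norm_measureFourier_coneMeasure_le (m N : ℕ) :
    ∃ A : ℝ, 0 < A ∧ ∀ (a c M : ℝ) (b : RSpace m), ‖b‖ ≤ M → 2 * |c| ≤ M →
      |a| ^ N * ‖measureFourier (coneMeasure m) (lightVec (2 * a) b (2 * c))‖ ≤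
        A * (1 + M ^ N) := by
  obtain ⟨C, hC, hdecay⟩ := exists_norm_fourier_radialDensity_le N
  obtain ⟨L, hL, hexp⟩ := exists_rpow_le_mul_exp N
  -- The bound on the `N`th power of the quadratic part of the phase costs `exp(|z|²)`; the weight
  -- can pay since `π > 1`.
  have hint := integrable_exp_neg_mul_norm_sq m (r := Real.pi - 1)
    (by linarith [Real.pi_gt_three])
  set D := ∫ z : RSpace m, Real.exp (-(Real.pi - 1) * ‖z‖ ^ 2) with hD
  have hD0 : 0 ≤ D := integral_nonneg fun z => (Real.exp_pos _).le
  refine ⟨2 ^ N * (C + L * D), by positivity, fun a c M b hb hc => ?_⟩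
  have hM : 0 ≤ M := (norm_nonneg b).trans hb
  rw [measureFourier_coneMeasure, Measure.volume_eq_prod,
    integral_prod_symm _ (integrable_coneDensity_mul_unitWave a c b)]
  have hfib : ∀ z : RSpace m, ∫ t : ℝ, (coneDensity (t, z) : ℂ) *
        unitWave (t * (a + (inner ℝ b z + c * ‖z‖ ^ 2))) =
      Real.exp (-Real.pi * ‖z‖ ^ 2) *
        ∫ t, radialDensity t * unitWave (t * (a + (inner ℝ b z + c * ‖z‖ ^ 2))) := fun z => by
    rw [← integral_const_mul]
    congr 1 with t
    rw [coneDensity]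
    push_cast
    ring
  simp only [hfib]
  have hpt : ∀ z : RSpace m, ‖((|a| ^ N : ℝ) : ℂ) * (Real.exp (-Real.pi * ‖z‖ ^ 2) *
      ∫ t, radialDensity t * unitWave (t * (a + (inner ℝ b z + c * ‖z‖ ^ 2))))‖ ≤
      2 ^ N * (C * Real.exp (-Real.pi * ‖z‖ ^ 2) +
        M ^ N * (L * Real.exp (-(Real.pi - 1) * ‖z‖ ^ 2))) := fun z => by
    set q := inner ℝ b z + c * ‖z‖ ^ 2 with hq
    set W := ‖∫ t, radialDensity t * unitWave (t * (a + q))‖ with hW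
    have hq' : |q| ≤ M * (1 + ‖z‖ ^ 2) := abs_quadratic_le hb hc z
    have hqN : |q| ^ N ≤ M ^ N * (L * Real.exp (‖z‖ ^ 2)) := by
      refine (pow_le_pow_left₀ (abs_nonneg q) hq' N).trans ?_
      rw [mul_pow]
      refine mul_le_mul_of_nonneg_left ?_ (by positivity)
      have := hexp (‖z‖ ^ 2) (sq_nonneg _)
      rwa [Real.rpow_natCast] at this
    -- Decay in `t` controls `a + q`, not `a`; the remaining power of `q` meets the trivial bound `W
    -- ≤ 1`.
    have ha : |a| ^ N ≤ 2 ^ N * (|a + q| ^ N + |q| ^ N) := by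
      have h1 : |a| ≤ 2 * max |a + q| |q| := by
        have h2 : |a| ≤ |a + q| + |q| := by
          simpa using abs_sub (a + q) q
        linarith [le_max_left |a + q| |q|, le_max_right |a + q| |q|]
      refine (pow_le_pow_left₀ (abs_nonneg a) h1 N).trans ?_
      rw [mul_pow]
      refine mul_le_mul_of_nonneg_left ?_ (by positivity)
      rcases max_cases |a + q| |q| with ⟨h, -⟩ | ⟨h, -⟩ <;> rw [h]
      · exact le_add_of_nonneg_right (by positivity)
      · exact le_add_of_nonneg_left (by positivity)
    have hW0 : 0 ≤ W := norm_nonneg _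
    have hW1 : W ≤ 1 := norm_fourier_radialDensity_le_one _
    have hWN : |a + q| ^ N * W ≤ C := hdecay _
    have hmain : |a| ^ N * W ≤ 2 ^ N * (C + M ^ N * (L * Real.exp (‖z‖ ^ 2))) := by
      refine (mul_le_mul_of_nonneg_right ha hW0).trans ?_
      rw [mul_assoc, add_mul]
      refine mul_le_mul_of_nonneg_left (add_le_add hWN ?_) (by positivity)
      exact (mul_le_of_le_one_right (by positivity) hW1).trans hqN
    rw [norm_mul, norm_mul, Complex.norm_real, Complex.norm_real,
      Real.norm_of_nonneg (by positivity), Real.norm_of_nonneg (by positivity), mul_left_comm,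
      show -(Real.pi - 1) * ‖z‖ ^ 2 = -Real.pi * ‖z‖ ^ 2 + ‖z‖ ^ 2 by ring, Real.exp_add]
    refine (mul_le_mul_of_nonneg_left hmain (Real.exp_pos _).le).trans (le_of_eq ?_)
    ring
  have hbnd := norm_integral_le_of_norm_le ((((integrable_exp_neg_mul_norm_sq m
    Real.pi_pos).const_mul C).add ((hint.const_mul L).const_mul (M ^ N))).const_mul (2 ^ N))
    (ae_of_all _ hpt)
  rw [integral_const_mul, norm_mul, Complex.norm_real, Real.norm_of_nonneg (by positivity)] at hbnd
  refine hbnd.trans ?_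
  simp only [Pi.add_apply]
  rw [integral_const_mul, integral_add ((integrable_exp_neg_mul_norm_sq m
    Real.pi_pos).const_mul C) ((hint.const_mul L).const_mul (M ^ N)), integral_const_mul,
    integral_const_mul, integral_const_mul, integral_gaussian_eq_one, ← hD, mul_assoc]
  refine mul_le_mul_of_nonneg_left ?_ (by positivity)
  have h1 : 0 ≤ L * D := by positivity
  have h2 : 0 ≤ C * M ^ N := by positivity
  nlinarith

theorem hasFourierDecay_coneMeasure {m : ℕ} {s : ℝ} (hs0 : 0 ≤ s) (hs : s < m) :
    HasFourierDecay (coneMeasure m) s := by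
  have hm : (0 : ℝ) < m := hs0.trans_lt hs
  obtain ⟨K, hK, hbound⟩ := exists_norm_measureFourier_coneMeasure_le m
  -- Threshold `ρ^α` for `(b, c)`: above it the Gaussian estimate gives `(ρ^(2α))^(-m/4) =
  -- ρ^(-s/2)`; below it `N` must satisfy `(1 - α)N ≥ s/2`, so `α < 1` is needed.
  set α := s / m with hα
  have hα0 : 0 ≤ α := by positivity
  have hα1 : α < 1 := (div_lt_one hm).2 hs
  obtain ⟨N, hN⟩ := exists_nat_ge (s / 2 / (1 - α))
  rw [div_le_iff₀ (by linarith)] at hN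
  obtain ⟨A, hA, hrapid⟩ := exists_pow_mul_norm_measureFourier_coneMeasure_le m N
  refine ⟨1 + K * (1 / 4) ^ (-(m / 4 : ℝ)) + A * 2 * 2 ^ N, fun ξ hξ => ?_⟩
  obtain ⟨u, b, v, rfl⟩ := exists_eq_lightVec ξ
  obtain ⟨a, rfl⟩ : ∃ a, u = 2 * a := ⟨u / 2, by ring⟩
  obtain ⟨c, rfl⟩ : ∃ c, v = 2 * c := ⟨v / 2, by ring⟩
  have hρ0 := norm_pos_iff.2 hξ
  have hρsq := norm_sq_lightVec (2 * a) (2 * c) b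
  set F := ‖measureFourier (coneMeasure m) (lightVec (2 * a) b (2 * c))‖ with hF
  set ρ := ‖lightVec (2 * a) b (2 * c)‖ with hρ
  have hP : 0 < ρ ^ (-s / 2) := by positivity
  have hK' : 0 < K * (1 / 4) ^ (-(m / 4 : ℝ)) := by positivity
  have hA' : 0 < A * 2 * 2 ^ N := by positivity
  rw [add_mul, add_mul, one_mul]
  rcases le_or_gt ρ 1 with hρ1 | hρ1
  · have h1 : F ≤ 1 := norm_measureFourier_le_one _ _
    have h2 : 1 ≤ ρ ^ (-s / 2) :=
      Real.one_le_rpow_of_pos_of_le_one_of_nonpos hρ0 hρ1 (by linarith)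
    nlinarith [mul_pos hK' hP, mul_pos hA' hP]
  rcases le_or_gt ((ρ ^ α) ^ 2 * (1 / 4)) (4 * c ^ 2 + ‖b‖ ^ 2) with hQ | hQ
  · have hQ0 : 0 < (ρ ^ α) ^ 2 * (1 / 4) := by positivity
    have h1 : F ≤ K * ((ρ ^ α) ^ 2 * (1 / 4)) ^ (-(m / 4 : ℝ)) :=
      (hbound a c b (hQ0.trans_le hQ)).trans (mul_le_mul_of_nonneg_left
        (Real.rpow_le_rpow_of_nonpos hQ0 hQ (neg_nonpos.2 (by positivity))) hK.le)
    have h2 : ((ρ ^ α) ^ 2 : ℝ) ^ (-(m / 4 : ℝ)) = ρ ^ (-s / 2) := by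
      rw [← Real.rpow_natCast (ρ ^ α), ← Real.rpow_mul hρ0.le, ← Real.rpow_mul hρ0.le, hα]
      congr 1
      push_cast
      field_simp
      ring
    rw [Real.mul_rpow (by positivity) (by norm_num), h2] at h1
    nlinarith [mul_pos hA' hP]
  · have hρα : ρ ^ α ≤ ρ := by
      simpa using Real.rpow_le_rpow_of_exponent_le hρ1.le hα1.le
    have hραsq : (ρ ^ α) ^ 2 ≤ ρ ^ 2 := pow_le_pow_left₀ (by positivity) hρα 2
    have hb : ‖b‖ ≤ ρ ^ α := by
      refine le_of_sq_le_sq ?_ (by positivity)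
      nlinarith [sq_nonneg c]
    have hc : 2 * |c| ≤ ρ ^ α := by
      refine le_of_sq_le_sq ?_ (by positivity)
      rw [mul_pow, sq_abs]
      nlinarith [sq_nonneg ‖b‖]
    -- From `ρ² = |b|² + 2a² + 2c²` and `4c² + |b|² < ρ²/4`.
    have ha : ρ / 2 ≤ |a| := by
      refine le_of_sq_le_sq ?_ (abs_nonneg a)
      rw [sq_abs]
      nlinarith [sq_nonneg ‖b‖]
    have h1 := hrapid a c (ρ ^ α) b hb hc
    have hραN : (ρ ^ α) ^ N = ρ ^ (α * N) := by
      rw [Real.rpow_mul hρ0.le, Real.rpow_natCast]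
    have h2 : (ρ / 2) ^ N * F ≤ A * (2 * ρ ^ (α * N)) := by
      refine ((mul_le_mul_of_nonneg_right (pow_le_pow_left₀ (by positivity) ha N)
        (norm_nonneg _)).trans h1).trans ?_
      rw [hραN]
      have : 1 ≤ ρ ^ (α * N) := Real.one_le_rpow hρ1.le (by positivity)
      exact mul_le_mul_of_nonneg_left (by linarith) hA.le
    have h3 : ρ ^ (α * N) ≤ ρ ^ N * ρ ^ (-s / 2) := by
      rw [← Real.rpow_natCast ρ N, ← Real.rpow_add hρ0]
      exact Real.rpow_le_rpow_of_exponent_le hρ1.le (by linarith)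
    have h4 : F ≤ A * 2 * 2 ^ N * ρ ^ (-s / 2) := by
      have hρN : 0 < ρ ^ N := by positivity
      rw [div_pow, div_mul_eq_mul_div, div_le_iff₀ (by positivity)] at h2
      refine le_of_mul_le_mul_left (h2.trans ?_) hρN
      have := mul_le_mul_of_nonneg_left h3 hA'.le
      linarith
    nlinarith [mul_pos hK' hP]

theorem mem_fourierExponents_cone {m : ℕ} {s : ℝ} (hs0 : 0 ≤ s) (hs : s < m) :
    s ∈ fourierExponents (cone (m + 1)) := by
  refine ⟨⟨hs0, ?_⟩, coneMeasure m, inferInstance, coneMeasure_cone m,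
    hasFourierDecay_coneMeasure hs0 hs⟩
  push_cast
  linarith

end

theorem mainTheorem1 (d : ℕ) (hd : 1 ≤ d) : fourierDim (cone d) = (d : ℝ) - 1 := by
  obtain ⟨m, rfl⟩ : ∃ m, d = m + 1 := ⟨d - 1, by omega⟩
  have hlub := isLUB_fourierDim ⟨_, conePoint_mem_cone (0 : ℝ × RSpace m)⟩
  rw [Nat.cast_add, Nat.cast_one, add_sub_cancel_right]
  refine le_antisymm (hlub.2 fun s hs => fourierExponents_cone_le hs) ?_
  refine le_of_forall_lt_imp_le_of_dense fun s hs => ?_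
  rcases le_or_gt 0 s with h0 | h0
  · exact hlub.1 (mem_fourierExponents_cone h0 hs)
  -- Negative `s` are not exponents; when `d = 1` this is the only case.
  · exact h0.le.trans (Real.sSup_nonneg fun t ht => ht.1.1)
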